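/- Let $d\ge 1$, and let $V_d$ be the space of complex binary forms of degree $d$, on which $SL_2(\mathbb C)$ acts by $(g\cdot f)(v)=f(g^{-1}v)$. Let $C_d$ be the algebra of covariants, i.e. of the polynomial functions $F$ on $V_d\times\mathbb C^2$ with $F(g\cdot f,gv)=F(f,v)$ for all $g\in SL_2(\mathbb C)$, $f\in V_d$, $v\in\mathbb C^2$, and let $(C_d)_n$ be the subspace of covariants that are homogeneous of degree $n$ in the coefficients of the form $f$. Then every $(C_d)_n$ is finite dimensional, and the Poincaré series $P_d(z)=\sum_{n\ge 0}\dim (C_d)_n\,z^n$ satisfies, in $\mathbb C[[z]]$, $$P_d(z)=\sum_{0\le k<d/2}\varphi_{d-2k}\left(\frac{(-1)^k z^{k(k+1)}(1+z)}{(z^2;z^2)_k\,(z^2;z^2)_{d-k}}\right),$$ where $\varphi_n\left(\sum_{m\ge0}a_mz^m\right)=\sum_{s\ge0}a_{ns}z^s$ for $n \ge 1$ and $(a;q)_n=(1-a)(1-aq)\cdots(1-aq^{n-1})$, with $(a;q)_0=1$. -/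

import Mathlib

open scoped MatrixGroups PowerSeries

namespace BinaryForms

/-- The complex vector space of binary forms of degree `d` (homogeneous polynomials of degree `d`
in two variables). -/
abbrev BinaryForm (d : ℕ) : Type :=
  MvPolynomial.homogeneousSubmodule (Fin 2) ℂ d

/-- The polynomial `p ∘ g⁻¹`, i.e. `p` with `X i` replaced by the `i`-th coordinate of `g⁻¹ X`. -/
noncomputable def subst (g : SL(2, ℂ)) :
    MvPolynomial (Fin 2) ℂ →ₐ[ℂ] MvPolynomial (Fin 2) ℂ :=
  MvPolynomial.aeval fun i =>
    ∑ j : Fin 2, MvPolynomial.C ((g⁻¹ : SL(2, ℂ)) i j) * MvPolynomial.X j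

theorem eval_subst (g : SL(2, ℂ)) (p : MvPolynomial (Fin 2) ℂ) (v : Fin 2 → ℂ) :
    MvPolynomial.eval v (subst g p) =
      MvPolynomial.eval (((g⁻¹ : SL(2, ℂ)) : Matrix (Fin 2) (Fin 2) ℂ).mulVec v) p := by
  induction p using MvPolynomial.induction_on with
  | C a => simp [subst]
  | add p q hp hq => simp only [map_add, hp, hq]
  | mul_X p i hp =>
    simp only [map_mul, hp]
    congr 1
    simp only [subst, MvPolynomial.aeval_X, map_sum, map_mul, MvPolynomial.eval_C,
      MvPolynomial.eval_X]
    rfl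

theorem subst_mem {d : ℕ} (g : SL(2, ℂ)) {p : MvPolynomial (Fin 2) ℂ}
    (hp : p ∈ MvPolynomial.homogeneousSubmodule (Fin 2) ℂ d) :
    subst g p ∈ MvPolynomial.homogeneousSubmodule (Fin 2) ℂ d := by
  rw [MvPolynomial.mem_homogeneousSubmodule] at hp ⊢
  have key : ∀ i : Fin 2, (∑ j : Fin 2, MvPolynomial.C (σ := Fin 2) ((g⁻¹ : SL(2, ℂ)) i j) *
      MvPolynomial.X j).IsHomogeneous 1 := fun i =>
    MvPolynomial.IsHomogeneous.sum _ _ _ fun j _ => MvPolynomial.isHomogeneous_C_mul_X _ j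
  have h := hp.aeval _ key
  rwa [one_mul] at h

/-- The natural action of `SL₂(ℂ)` on binary forms of degree `d`: `(g · f)(v) = f(g⁻¹ v)`. -/
noncomputable def act {d : ℕ} (g : SL(2, ℂ)) (f : BinaryForm d) : BinaryForm d :=
  ⟨subst g f.1, subst_mem g f.2⟩

/-- The coefficients of a binary form: `coords f i` is the coefficient of `x^(d-i) y^i`. -/
noncomputable def coords {d : ℕ} (f : BinaryForm d) (i : Fin (d + 1)) : ℂ :=
  MvPolynomial.coeff (Finsupp.single 0 (d - (i : ℕ)) + Finsupp.single 1 (i : ℕ)) f.1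

/-- The value at a form `f` and a point `v` of a polynomial in the `d + 1` coefficients of a
binary form of degree `d` and in the two coordinates of a point of `ℂ²`. -/
noncomputable def value {d : ℕ} (F : MvPolynomial (Fin (d + 1) ⊕ Fin 2) ℂ)
    (f : BinaryForm d) (v : Fin 2 → ℂ) : ℂ :=
  MvPolynomial.eval (Sum.elim (coords f) v) F

/-- The algebra `C_d` of covariants of the binary form of degree `d`: the polynomial functions on
(binary forms of degree `d`) × `ℂ²` that are invariant under the diagonal action of `SL₂(ℂ)`. -/
noncomputable def covariants (d : ℕ) : Subalgebra ℂ (MvPolynomial (Fin (d + 1) ⊕ Fin 2) ℂ) where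
  carrier := {F | ∀ (g : SL(2, ℂ)) (f : BinaryForm d) (v : Fin 2 → ℂ),
    value F (act g f) ((g : Matrix (Fin 2) (Fin 2) ℂ).mulVec v) = value F f v}
  mul_mem' := fun ha hb g f v => by
    have h1 := ha g f v
    have h2 := hb g f v
    simp only [value, map_mul] at h1 h2 ⊢
    rw [h1, h2]
  add_mem' := fun ha hb g f v => by
    have h1 := ha g f v
    have h2 := hb g f v
    simp only [value, map_add] at h1 h2 ⊢
    rw [h1, h2]
  algebraMap_mem' := fun r g f v => by
    simp [value, MvPolynomial.algebraMap_eq]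

/-- The graded piece `(C_d)_n`: the covariants that are homogeneous of degree `n` in the
coefficients of the form (and of arbitrary order in the point of `ℂ²`). -/
noncomputable def covariantsOfDegree (d n : ℕ) :
    Submodule ℂ (MvPolynomial (Fin (d + 1) ⊕ Fin 2) ℂ) :=
  Subalgebra.toSubmodule (covariants d) ⊓
    MvPolynomial.weightedHomogeneousSubmodule ℂ
      (Sum.elim (fun _ => 1) (fun _ => 0) : Fin (d + 1) ⊕ Fin 2 → ℕ) n

/-- The Poincaré series `P_d(z) = ∑ dim (C_d)_n z^n`. -/
noncomputable def poincareSeries (d : ℕ) : ℂ⟦X⟧ :=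
  PowerSeries.mk fun n => (Module.finrank ℂ (covariantsOfDegree d n) : ℂ)

/-- `φ_n`, sending `∑ a_m z^m` to `∑ a_{ns} z^s`. -/
noncomputable def phi (n : ℕ) : ℂ⟦X⟧ →ₗ[ℂ] ℂ⟦X⟧ where
  toFun A := PowerSeries.mk fun s => PowerSeries.coeff (n * s) A
  map_add' A B := by ext s; simp
  map_smul' c A := by ext s; simp

/-- The `q`-shifted factorial `(a; q)_n = (1 - a)(1 - a q) ⋯ (1 - a q^(n-1))`. -/
noncomputable def qShifted (a q : ℂ⟦X⟧) (n : ℕ) : ℂ⟦X⟧ :=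
  ∏ i ∈ Finset.range n, (1 - a * q ^ i)

/-- The denominators occurring in the formula are invertible power series. -/
theorem constantCoeff_qShifted (n : ℕ) :
    PowerSeries.constantCoeff (qShifted ((PowerSeries.X : ℂ⟦X⟧) ^ 2) (PowerSeries.X ^ 2) n) = 1 := by
  simp [qShifted, map_prod]

end BinaryForms

/-! A covariant `F` is determined by its leading coefficient, the function `f ↦ F(f, (1, 0))`,
because `SL₂` moves `(1, 0)` to every nonzero vector. That function is invariant under the
stabiliser of `(1, 0)`, the unipotent upper triangular group; infinitesimally, it is killed by the
derivation `lower`. Conversely every such semi-invariant comes from a covariant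
(`exists_covariant_of_semiinvariant`), so `(C_d)_n` is isomorphic to the kernel of `lower` in degree
`n` (`leadingEquiv`).

The operators `lower` and `raise` satisfy the `sl₂` relations on polynomials of degree `n`, and `dn
- 2w` is the eigenvalue of their commutator in weight `w`. Hence `lower` is injective on weights
above `dn/2`, and every polynomial of weight below `dn/2` lies in its image. Rank-nullity in weights
at most `⌊nd/2⌋` then gives the kernel as many dimensions as there are monomials of degree `n` and
weight exactly `⌊nd/2⌋` (`finrank_semiinvariants`).

With `q = X ^ 2`, the monomials of degree `n` are counted by weight by the Gaussian binomial `[n +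
d, d]`, and multiplying by `1 + X` makes the coefficient of `X ^ (nd)` the required number for
either parity of `nd`. Expanding the binomial gives a sum over `k` whose dependence on `n` is only
the factor `X ^ (2nk)` (`weightSeries_eq_partialFractions`). Removing this factor turns the
coefficient at `nd` into the one at `n(d - 2k)`, which is what `φ_{d-2k}` extracts; for `2k ≥ d` the
term starts beyond `X ^ (nd)` and contributes nothing. -/

namespace BinaryForms

/-! ### Monomials counted by weight: Gaussian binomials and their expansion -/

section Counting

open PowerSeries Finset

/-- The generating function `∑ X ^ (2 * ∑ i * s i)` of the exponent vectors `s` of degree `n` in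
`d + 1` variables. -/
noncomputable def weightSeries (d n : ℕ) : ℂ⟦X⟧ :=
  ∑ s ∈ Finset.Nat.antidiagonalTuple (d + 1) n, X ^ (2 * ∑ i : Fin (d + 1), (i : ℕ) * s i)

theorem weightSeries_zero_right (d : ℕ) : weightSeries d 0 = 1 := by
  simp [weightSeries, Finset.Nat.antidiagonalTuple_zero_right]

theorem weightSeries_zero_left (n : ℕ) : weightSeries 0 n = 1 := by
  simp [weightSeries]

/-- The Pascal recursion. If `s 0` is positive, lowering it by one leaves the weight unchanged,
since index `0` has weight `0`. If `s 0 = 0`, dropping it shifts every index down by one and costs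
the total degree `n + 1` in weight. -/
theorem weightSeries_succ_succ (d n : ℕ) :
    weightSeries (d + 1) (n + 1) =
      weightSeries (d + 1) n + X ^ (2 * (n + 1)) * weightSeries d (n + 1) := by
  unfold weightSeries
  rw [← Finset.sum_filter_add_sum_filter_not _ (fun s : Fin (d + 1 + 1) → ℕ => s 0 ≠ 0)]
  congr 1
  · refine Finset.sum_nbij' (fun s => Fin.cons (s 0 - 1) (Fin.tail s))
      (fun s => Fin.cons (s 0 + 1) (Fin.tail s)) ?_ ?_ ?_ ?_ ?_
    · intro s hs
      simp only [mem_filter, Finset.Nat.mem_antidiagonalTuple, Fin.sum_univ_succ (n := d + 1)]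
        at hs ⊢
      simp only [Fin.cons_zero, Fin.cons_succ, Fin.tail]
      omega
    · intro s hs
      simp only [mem_filter, Finset.Nat.mem_antidiagonalTuple, Fin.sum_univ_succ (n := d + 1)]
        at hs ⊢
      simp only [Fin.cons_zero, Fin.cons_succ, Fin.tail]
      omega
    · intro s hs
      simp only [mem_filter] at hs
      have h : s 0 - 1 + 1 = s 0 := by omega
      simp [h]
    · intro s hs
      simp
    · intro s hs
      simp [Fin.sum_univ_succ (n := d + 1), Fin.tail]
  · rw [Finset.mul_sum]
    refine Finset.sum_nbij' (fun s => Fin.tail s) (fun s => Fin.cons 0 s) ?_ ?_ ?_ ?_ ?_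
    · intro s hs
      simp only [mem_filter, Finset.Nat.mem_antidiagonalTuple, Fin.sum_univ_succ (n := d + 1)]
        at hs ⊢
      simp only [Fin.tail]
      omega
    · intro s hs
      simp only [mem_filter, Finset.Nat.mem_antidiagonalTuple, Fin.sum_univ_succ (n := d + 1)]
        at hs ⊢
      simp only [Fin.cons_zero, Fin.cons_succ]
      omega
    · intro s hs
      simp only [mem_filter, not_not] at hs
      rw [← hs.2]
      simp
    · intro s hs
      simp
    · intro s hs
      simp only [mem_filter, not_not, Finset.Nat.mem_antidiagonalTuple,
        Fin.sum_univ_succ (n := d + 1)] at hs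
      rw [hs.2, zero_add] at hs
      rw [← pow_add, Fin.sum_univ_succ (n := d + 1), ← hs.1, ← mul_add]
      simp [Fin.tail, ← Finset.sum_add_distrib, add_mul, add_comm]

/-- The inverse of `(X ^ 2; X ^ 2)_k`. -/
noncomputable def invQ (k : ℕ) : ℂ⟦X⟧ :=
  (qShifted ((X : ℂ⟦X⟧) ^ 2) (X ^ 2) k)⁻¹

theorem invQ_zero : invQ 0 = 1 := by simp [invQ, qShifted]

theorem invQ_succ_mul (k : ℕ) : invQ (k + 1) * (1 - X ^ (2 * (k + 1))) = invQ k := by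
  have h := constantCoeff_qShifted k
  have h1 := constantCoeff_qShifted (k + 1)
  have e : qShifted ((X : ℂ⟦X⟧) ^ 2) (X ^ 2) (k + 1) =
      qShifted ((X : ℂ⟦X⟧) ^ 2) (X ^ 2) k * (1 - X ^ (2 * (k + 1))) := by
    rw [qShifted, Finset.prod_range_succ, qShifted]
    ring
  have i0 : qShifted ((X : ℂ⟦X⟧) ^ 2) (X ^ 2) k * invQ k = 1 :=
    PowerSeries.mul_inv_cancel _ (by rw [h]; exact one_ne_zero)
  have i1 : qShifted ((X : ℂ⟦X⟧) ^ 2) (X ^ 2) (k + 1) * invQ (k + 1) = 1 :=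
    PowerSeries.mul_inv_cancel _ (by rw [h1]; exact one_ne_zero)
  calc invQ (k + 1) * (1 - X ^ (2 * (k + 1)))
      = invQ (k + 1) * (1 - X ^ (2 * (k + 1))) *
          (qShifted ((X : ℂ⟦X⟧) ^ 2) (X ^ 2) k * invQ k) := by rw [i0, mul_one]
    _ = (qShifted ((X : ℂ⟦X⟧) ^ 2) (X ^ 2) (k + 1) * invQ (k + 1)) * invQ k := by rw [e]; ring
    _ = invQ k := by rw [i1, one_mul]

/-- The partial fraction expansion of the Gaussian binomial `[n + d, d]` at `q = X ^ 2`. -/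
noncomputable def partialFractions (d n : ℕ) : ℂ⟦X⟧ :=
  ∑ k ∈ range (d + 1), (-1) ^ k * X ^ (k * (k + 1) + 2 * n * k) * (invQ k * invQ (d - k))

/-- The `k`-th terms of the two sums for `d + 1` differ by the factor `X ^ (2k)`; the resulting `1 -
X ^ (2k)` cancels the last factor of `(X ^ 2; X ^ 2)_k`, and `k` shifts by one. -/
theorem partialFractions_succ_succ (d n : ℕ) :
    partialFractions (d + 1) (n + 1) =
      partialFractions (d + 1) n + X ^ (2 * (n + 1)) * partialFractions d (n + 1) := by
  rw [← sub_eq_iff_eq_add', partialFractions, partialFractions, partialFractions,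
    ← Finset.sum_sub_distrib, Finset.sum_range_succ', Finset.mul_sum]
  simp only [mul_zero, sub_self, add_zero, zero_mul]
  refine Finset.sum_congr rfl fun k _ => ?_
  rw [← invQ_succ_mul k, Nat.add_sub_add_right]
  ring

theorem partialFractions_zero_right (d : ℕ) : partialFractions d 0 = 1 := by
  induction d with
  | zero => simp [partialFractions, invQ_zero]
  | succ d ih =>
    -- The companion sum `B` allows a factor to be cancelled from either denominator: `h1` shortens
    -- `(X ^ 2; X ^ 2)_{d+1-k}` and `h2` shortens `(X ^ 2; X ^ 2)_k`. Eliminating `B` leaves the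
    -- claim multiplied by the nonzero series `1 - X ^ (2(d + 1))`.
    set B : ℂ⟦X⟧ := ∑ k ∈ range (d + 1 + 1),
      (-1) ^ k * X ^ (k * (k - 1)) * (invQ k * invQ (d + 1 - k)) with hB
    have hexp : ∀ k : ℕ, k * (k + 1) = k * (k - 1) + 2 * k := by
      rintro (_ | k)
      · rfl
      · simp only [Nat.add_sub_cancel]; ring
    have h1 : partialFractions (d + 1) 0 - X ^ (2 * (d + 1)) * B = partialFractions d 0 := by
      rw [hB, partialFractions, partialFractions, Finset.mul_sum, ← Finset.sum_sub_distrib,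
        Finset.sum_range_succ]
      have h0 : (-1 : ℂ⟦X⟧) ^ (d + 1) * X ^ ((d + 1) * (d + 1 + 1) + 2 * 0 * (d + 1)) *
          (invQ (d + 1) * invQ (d + 1 - (d + 1))) - X ^ (2 * (d + 1)) *
          ((-1) ^ (d + 1) * X ^ ((d + 1) * (d + 1 - 1)) *
            (invQ (d + 1) * invQ (d + 1 - (d + 1)))) = 0 := by
        rw [hexp]; ring
      rw [h0, add_zero]
      refine Finset.sum_congr rfl fun k hk => ?_
      obtain ⟨j, rfl⟩ := Nat.exists_eq_add_of_le (Nat.lt_succ_iff.1 (mem_range.1 hk))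
      have e1 : k + j + 1 - k = j + 1 := by omega
      have e2 : k + j - k = j := by omega
      rw [e1, e2, ← invQ_succ_mul j, hexp]
      ring
    have h2 : B - partialFractions (d + 1) 0 = -partialFractions d 0 := by
      rw [hB, partialFractions, partialFractions, ← Finset.sum_sub_distrib,
        Finset.sum_range_succ', ← Finset.sum_neg_distrib]
      simp only [mul_zero, zero_mul, sub_self, add_zero, Nat.add_sub_cancel]
      refine Finset.sum_congr rfl fun k _ => ?_
      rw [← invQ_succ_mul k, Nat.add_sub_add_right]
      ring
    have h3 : (1 - X ^ (2 * (d + 1)) : ℂ⟦X⟧) * (partialFractions (d + 1) 0 - 1) = 0 := by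
      rw [ih] at h1 h2
      linear_combination h1 + X ^ (2 * (d + 1)) * h2
    have h4 : (1 - X ^ (2 * (d + 1)) : ℂ⟦X⟧) ≠ 0 := by
      intro h
      have := congrArg (PowerSeries.constantCoeff (R := ℂ)) h
      simp at this
    exact sub_eq_zero.1 ((mul_eq_zero.1 h3).resolve_left h4)

theorem weightSeries_eq_partialFractions (d n : ℕ) : weightSeries d n = partialFractions d n := by
  induction d generalizing n with
  | zero => rw [weightSeries_zero_left]; simp [partialFractions, invQ_zero]
  | succ d ihd =>
    induction n with
    | zero => rw [weightSeries_zero_right, partialFractions_zero_right]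
    | succ n ihn => rw [weightSeries_succ_succ, partialFractions_succ_succ, ihd, ihn]

/-- All exponents in `weightSeries` are even, so of the summands `1` and `X` exactly one has the
parity that can reach `m`. -/
theorem coeff_one_add_X_mul_weightSeries (d n m : ℕ) :
    PowerSeries.coeff m ((1 + X) * weightSeries d n) =
      (((Finset.Nat.antidiagonalTuple (d + 1) n).filter
        fun s => ∑ i : Fin (d + 1), (i : ℕ) * s i = m / 2).card : ℂ) := by
  rw [weightSeries, Finset.mul_sum, map_sum, Finset.card_filter, Nat.cast_sum]
  refine Finset.sum_congr rfl fun s _ => ?_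
  rw [add_mul, one_mul, ← pow_succ', map_add, PowerSeries.coeff_X_pow, PowerSeries.coeff_X_pow]
  split_ifs <;> first | omega | simp

theorem coeff_sum_phi (d : ℕ) (hd : 1 ≤ d) (n : ℕ) :
    PowerSeries.coeff n (∑ k ∈ (Finset.range d).filter (fun k => 2 * k < d),
        phi (d - 2 * k) ((-1) ^ k * X ^ (k * (k + 1)) * (1 + X) *
            (qShifted (X ^ 2) (X ^ 2) k * qShifted (X ^ 2) (X ^ 2) (d - k))⁻¹)) =
      (((Finset.Nat.antidiagonalTuple (d + 1) n).filter
        fun s => ∑ i : Fin (d + 1), (i : ℕ) * s i = n * d / 2).card : ℂ) := by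
  rw [← coeff_one_add_X_mul_weightSeries, weightSeries_eq_partialFractions, partialFractions,
    Finset.mul_sum, map_sum, map_sum]
  have hsub : (range d).filter (fun k => 2 * k < d) ⊆ range (d + 1) := fun k hk => by
    simp only [mem_filter, mem_range] at hk ⊢; omega
  refine Finset.sum_subset_zero_on_sdiff hsub ?_ ?_
  · intro k hk
    simp only [mem_sdiff, mem_filter, mem_range, not_and, not_lt] at hk
    have hdk : d ≤ 2 * k := by
      by_cases h : k < d
      · exact hk.2 h
      · omega
    have e : (1 + X : ℂ⟦X⟧) * ((-1) ^ k * X ^ (k * (k + 1) + 2 * n * k) *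
        (invQ k * invQ (d - k))) = X ^ (k * (k + 1) + 2 * n * k) *
        ((1 + X) * (-1) ^ k * (invQ k * invQ (d - k))) := by ring
    -- The exponent `k(k + 1) + 2nk` exceeds `nd`, as `d ≤ 2k` and `k > 0`.
    rw [e, PowerSeries.coeff_X_pow_mul', if_neg]
    have h1 : n * d ≤ n * (2 * k) := Nat.mul_le_mul_left n hdk
    have h2 : 0 < k * (k + 1) := by
      have : 0 < k := by omega
      positivity
    have h3 : 2 * n * k = n * (2 * k) := by ring
    omega
  · intro k hk
    simp only [mem_filter, mem_range] at hk
    have e : (1 + X : ℂ⟦X⟧) * ((-1) ^ k * X ^ (k * (k + 1) + 2 * n * k) *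
        (invQ k * invQ (d - k))) = X ^ (2 * n * k) *
        ((-1) ^ k * X ^ (k * (k + 1)) * (1 + X) *
            (qShifted (X ^ 2) (X ^ 2) k * qShifted (X ^ 2) (X ^ 2) (d - k))⁻¹) := by
      rw [PowerSeries.mul_inv_rev, invQ, invQ]; ring
    have h1 : n * (2 * k) ≤ n * d := Nat.mul_le_mul_left n hk.2.le
    have h3 : 2 * n * k = n * (2 * k) := by ring
    rw [e, PowerSeries.coeff_X_pow_mul', if_pos (by omega)]
    simp only [phi, LinearMap.coe_mk, AddHom.coe_mk, PowerSeries.coeff_mk]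
    -- After division by `X ^ (2nk)` the index is `nd - 2nk = (d - 2k)n`, as in `phi (d - 2 * k)`.
    rw [h3, ← Nat.mul_sub, Nat.mul_comm]

end Counting

/-! ### Derivations and weighted gradings -/

section GradedDerivations

open MvPolynomial

variable {σ M : Type*}

theorem mkDerivation_eq_sum_pderiv [Fintype σ] (f : σ → MvPolynomial σ ℂ) (p : MvPolynomial σ ℂ) :
    mkDerivation ℂ f p = ∑ i, pderiv i p * f i := by
  classical
  have happ : ∀ q : MvPolynomial σ ℂ, (∑ i, f i • (pderiv i :
      Derivation ℂ (MvPolynomial σ ℂ) (MvPolynomial σ ℂ))) q = ∑ i, f i * pderiv i q := fun q => by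
    have := congrFun (map_sum Derivation.coeFnAddMonoidHom (fun i => f i • (pderiv i :
      Derivation ℂ (MvPolynomial σ ℂ) (MvPolynomial σ ℂ))) Finset.univ) q
    rw [Finset.sum_apply] at this
    exact this
  have h : mkDerivation ℂ f = ∑ i, f i • (pderiv i : Derivation ℂ (MvPolynomial σ ℂ) _) := by
    refine derivation_ext fun j => ?_
    rw [mkDerivation_X, happ, Finset.sum_eq_single j]
    · simp
    · intro i _ hij
      simp [pderiv_X_of_ne hij.symm]
    · simp
  rw [h, happ]
  exact Finset.sum_congr rfl fun i _ => mul_comm _ _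

theorem isWeightedHomogeneous_mkDerivation [Fintype σ] [AddCommGroup M] {w : σ → M} {δ m : M}
    {f : σ → MvPolynomial σ ℂ} (hf : ∀ i, IsWeightedHomogeneous w (f i) (w i + δ))
    {p : MvPolynomial σ ℂ} (hp : IsWeightedHomogeneous w p m) :
    IsWeightedHomogeneous w (mkDerivation ℂ f p) (m + δ) := by
  rw [mkDerivation_eq_sum_pderiv]
  refine IsWeightedHomogeneous.sum _ _ _ fun i _ => ?_
  have h := (hp.pderiv (n' := m - w i) (i := i) (by abel)).mul (hf i)
  rwa [show m - w i + (w i + δ) = m + δ by abel] at h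

/-- Euler's identity for a general grading; it makes the commutator of `lower` and `raise` a scalar
on each bidegree. -/
theorem mkDerivation_diagonal [Fintype σ] [AddCommMonoid M] {w : σ → M} (χ : M →+ ℂ) {m : M}
    {p : MvPolynomial σ ℂ} (hp : IsWeightedHomogeneous w p m) :
    mkDerivation ℂ (fun i => C (χ (w i)) * X i) p = C (χ m) * p := by
  induction hp using IsWeightedHomogeneous.induction_on with
  | zero => simp
  | add p q _ _ h1 h2 => rw [map_add, h1, h2, mul_add]
  | monomial s r hr =>
    rw [mkDerivation_eq_sum_pderiv, ← hr, Finsupp.weight_apply,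
      Finsupp.sum_fintype _ _ (by simp), map_sum, map_sum, Finset.sum_mul]
    refine Finset.sum_congr rfl fun i _ => ?_
    have h := X_mul_pderiv_monomial (i := i) (m := s) (r := r)
    calc pderiv i (monomial s r) * (C (χ (w i)) * X i)
        = C (χ (w i)) * (X i * pderiv i (monomial s r)) := by ring
      _ = _ := by rw [h, map_nsmul, map_nsmul, smul_mul_assoc, mul_smul_comm]

theorem weightedHomogeneousComponent_comm [AddCommGroup M] [DecidableEq M] {w : σ → M} {δ : M}
    (D : MvPolynomial σ ℂ →ₗ[ℂ] MvPolynomial σ ℂ)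
    (hD : ∀ (m : M) (p : MvPolynomial σ ℂ), IsWeightedHomogeneous w p m →
      IsWeightedHomogeneous w (D p) (m + δ)) (m : M) (p : MvPolynomial σ ℂ) :
    D (weightedHomogeneousComponent w m p) = weightedHomogeneousComponent w (m + δ) (D p) := by
  induction p using MvPolynomial.monomial_add_induction_on with
  | C a =>
    have h : IsWeightedHomogeneous w (C a : MvPolynomial σ ℂ) (0 : M) :=
      isWeightedHomogeneous_C w a
    rw [weightedHomogeneousComponent_of_mem h, weightedHomogeneousComponent_of_mem (hD _ _ h)]
    simp only [add_left_inj]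
    split_ifs <;> simp
  | monomial_add s a p _ _ hp =>
    have h : IsWeightedHomogeneous w (monomial s a : MvPolynomial σ ℂ) (Finsupp.weight w s) :=
      isWeightedHomogeneous_monomial w s a rfl
    rw [map_add, map_add, map_add, map_add, hp, weightedHomogeneousComponent_of_mem h,
      weightedHomogeneousComponent_of_mem (hD _ _ h)]
    simp only [add_left_inj]
    split_ifs <;> simp

end GradedDerivations

/-! ### The `sl₂` action on polynomials in the coefficients -/

section Semiinvariants

open MvPolynomial

/-- The `k`-th coefficient of the generic form of degree `d`, zero if `d < k`. -/
noncomputable def coeffVar (d k : ℕ) : MvPolynomial (Fin (d + 1)) ℂ :=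
  if h : k < d + 1 then X ⟨k, h⟩ else 0

theorem coeffVar_val (d : ℕ) (i : Fin (d + 1)) : coeffVar d i = X i :=
  dif_pos i.isLt

/-- The lowering operator `a_i ↦ (d - i + 1) a_{i - 1}`. -/
noncomputable def lower (d : ℕ) :
    Derivation ℂ (MvPolynomial (Fin (d + 1)) ℂ) (MvPolynomial (Fin (d + 1)) ℂ) :=
  mkDerivation ℂ fun i => C ((d : ℂ) - (i : ℕ) + 1) *
    (if (i : ℕ) = 0 then 0 else coeffVar d ((i : ℕ) - 1))

/-- The raising operator `a_i ↦ (i + 1) a_{i + 1}`. -/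
noncomputable def raise (d : ℕ) :
    Derivation ℂ (MvPolynomial (Fin (d + 1)) ℂ) (MvPolynomial (Fin (d + 1)) ℂ) :=
  mkDerivation ℂ fun i => C (((i : ℕ) : ℂ) + 1) * coeffVar d ((i : ℕ) + 1)

/-- The degree and the weight of the coefficients of a form. -/
def bidegree (d : ℕ) (i : Fin (d + 1)) : ℤ × ℤ := (1, ((i : ℕ) : ℤ))

theorem weight_bidegree {d : ℕ} (s : Fin (d + 1) →₀ ℕ) :
    Finsupp.weight (bidegree d) s =
      (((∑ i, s i : ℕ) : ℤ), ((∑ i : Fin (d + 1), (i : ℕ) * s i : ℕ) : ℤ)) := by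
  rw [Finsupp.weight_apply, Finsupp.sum_fintype _ _ (by simp)]
  ext
  · simp [bidegree, Prod.fst_sum]
  · simp [bidegree, Prod.snd_sum, mul_comm]

/-- The eigenvalues of `⁅lower, raise⁆`. -/
noncomputable def sl2Weight (d : ℕ) : ℤ × ℤ →+ ℂ where
  toFun m := d * m.1 - 2 * m.2
  map_zero' := by simp
  map_add' a b := by push_cast [Prod.fst_add, Prod.snd_add]; ring

theorem sl2Weight_apply (d : ℕ) (n w : ℤ) : sl2Weight d (n, w) = d * n - 2 * w := rfl

theorem lower_coeffVar_succ (d k : ℕ) :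
    lower d (coeffVar d (k + 1)) = C ((d : ℂ) - k) * coeffVar d k := by
  by_cases h : k + 1 < d + 1
  · rw [coeffVar, dif_pos h, lower, mkDerivation_X, if_neg k.succ_ne_zero, Nat.add_sub_cancel]
    congr 2
    push_cast
    ring
  · rw [coeffVar, dif_neg h, map_zero]
    by_cases h' : k < d + 1
    -- At the top index the convention `a_{d+1} = 0` is consistent because the factor `d - k`
    -- vanishes there.
    · obtain rfl : k = d := by omega
      simp
    · rw [coeffVar, dif_neg h', mul_zero]

theorem raise_coeffVar (d k : ℕ) :
    raise d (coeffVar d k) = C ((k : ℂ) + 1) * coeffVar d (k + 1) := by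
  by_cases h : k < d + 1
  · rw [coeffVar, dif_pos h, raise, mkDerivation_X]
  · rw [coeffVar, dif_neg h, map_zero, coeffVar, dif_neg (by omega), mul_zero]

theorem commutator_lower_raise (d : ℕ) :
    ⁅lower d, raise d⁆ = mkDerivation ℂ fun i => C (sl2Weight d (bidegree d i)) * X i := by
  refine derivation_ext fun i => ?_
  rw [Derivation.commutator_apply, mkDerivation_X, bidegree, sl2Weight_apply]
  rw [← coeffVar_val, raise_coeffVar, Derivation.leibniz, derivation_C, lower_coeffVar_succ]
  rcases hi : (i : ℕ) with _ | k
  · have h0 : lower d (coeffVar d 0) = 0 := by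
      have h := congrArg (lower d) (coeffVar_val d i)
      rw [hi] at h
      rw [h, lower, mkDerivation_X, if_pos hi, mul_zero]
    simp [h0]
  · rw [lower_coeffVar_succ, Derivation.leibniz, derivation_C, raise_coeffVar]
    simp only [smul_eq_mul, mul_zero, add_zero, ← mul_assoc, ← C_mul]
    rw [← sub_mul, ← C_sub]
    congr 2
    push_cast
    ring

theorem isWeightedHomogeneous_coeffVar (d k : ℕ) :
    IsWeightedHomogeneous (bidegree d) (coeffVar d k) (1, (k : ℤ)) := by
  unfold coeffVar
  split_ifs with h
  · exact isWeightedHomogeneous_X ℂ (bidegree d) ⟨k, h⟩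
  · exact isWeightedHomogeneous_zero _ _ _

theorem isWeightedHomogeneous_lower {d : ℕ} {m : ℤ × ℤ} {p : MvPolynomial (Fin (d + 1)) ℂ}
    (hp : IsWeightedHomogeneous (bidegree d) p m) :
    IsWeightedHomogeneous (bidegree d) (lower d p) (m + (0, -1)) := by
  refine isWeightedHomogeneous_mkDerivation (fun i => ?_) hp
  refine IsWeightedHomogeneous.C_mul ?_ _
  split_ifs with h
  · exact isWeightedHomogeneous_zero _ _ _
  · have e : bidegree d i + (0, -1) = (1, (((i : ℕ) - 1 : ℕ) : ℤ)) := by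
      simp only [bidegree, Prod.mk_add_mk, Prod.mk.injEq]; omega
    rw [e]
    exact isWeightedHomogeneous_coeffVar d ((i : ℕ) - 1)

theorem isWeightedHomogeneous_raise {d : ℕ} {n w : ℤ} {p : MvPolynomial (Fin (d + 1)) ℂ}
    (hp : IsWeightedHomogeneous (bidegree d) p (n, w)) :
    IsWeightedHomogeneous (bidegree d) (raise d p) (n, w + 1) := by
  have h := isWeightedHomogeneous_mkDerivation (δ := (0, 1)) (f := fun i : Fin (d + 1) =>
    C (((i : ℕ) : ℂ) + 1) * coeffVar d ((i : ℕ) + 1)) (fun i => ?_) hp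
  · simpa [raise] using h
  · refine IsWeightedHomogeneous.C_mul ?_ _
    have e : bidegree d i + (0, 1) = (1, (((i : ℕ) + 1 : ℕ) : ℤ)) := by
      simp [bidegree]
    rw [e]
    exact isWeightedHomogeneous_coeffVar d ((i : ℕ) + 1)

theorem isWeightedHomogeneous_iterate_raise {d : ℕ} {n w : ℤ} {p : MvPolynomial (Fin (d + 1)) ℂ}
    (hp : IsWeightedHomogeneous (bidegree d) p (n, w)) (k : ℕ) :
    IsWeightedHomogeneous (bidegree d) ((raise d)^[k] p) (n, w + k) := by
  induction k with
  | zero => simpa using hp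
  | succ k ih =>
    rw [Function.iterate_succ_apply']
    have h := isWeightedHomogeneous_raise ih
    rwa [show w + (k : ℤ) + 1 = w + (k + 1 : ℕ) by push_cast; ring] at h

theorem lower_raise {d : ℕ} {n w : ℤ} {p : MvPolynomial (Fin (d + 1)) ℂ}
    (hp : IsWeightedHomogeneous (bidegree d) p (n, w)) :
    lower d (raise d p) = raise d (lower d p) + ((d : ℂ) * n - 2 * w) • p := by
  have h := mkDerivation_diagonal (sl2Weight d) hp
  rw [← commutator_lower_raise, Derivation.commutator_apply, sl2Weight_apply] at h
  rw [smul_eq_C_mul, ← h]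
  ring

/-- The standard `sl₂` string formula: each passage of `lower` across a `raise` contributes the
current eigenvalue, and these sum to `(k + 1)(dn - 2w - k)`. -/
theorem lower_iterate_raise {d : ℕ} {n w : ℤ} {p : MvPolynomial (Fin (d + 1)) ℂ}
    (hp : IsWeightedHomogeneous (bidegree d) p (n, w)) (k : ℕ) :
    lower d ((raise d)^[k + 1] p) = (raise d)^[k + 1] (lower d p) +
      ((k + 1) * ((d : ℂ) * n - 2 * w - k)) • (raise d)^[k] p := by
  induction k with
  | zero => simpa using lower_raise hp
  | succ k ih =>
    rw [Function.iterate_succ_apply' _ (k + 1) p,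
      lower_raise (isWeightedHomogeneous_iterate_raise hp (k + 1)), ih, map_add,
      ← Function.iterate_succ_apply' (raise d), (raise d).map_smul,
      ← Function.iterate_succ_apply' (raise d) k, add_assoc, ← add_smul]
    congr 2
    push_cast
    ring

theorem eq_zero_of_isWeightedHomogeneous {d : ℕ} {n w : ℤ} {p : MvPolynomial (Fin (d + 1)) ℂ}
    (hp : IsWeightedHomogeneous (bidegree d) p (n, w)) (hw : w < 0 ∨ d * n < w) : p = 0 := by
  ext s
  rw [coeff_zero]
  by_contra hs
  have h := hp hs
  rw [weight_bidegree, Prod.mk.injEq] at h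
  have h1 : ∑ i : Fin (d + 1), (i : ℕ) * s i ≤ d * ∑ i, s i := by
    rw [Finset.mul_sum]
    exact Finset.sum_le_sum fun i _ => Nat.mul_le_mul_right _ (by omega)
  zify at h1
  push_cast at h h1
  rw [h.1, h.2] at h1
  have h2 : 0 ≤ w := by rw [← h.2]; positivity
  omega

/-- Raising `p` often enough pushes its weight beyond `dn`, giving zero. The string formula then
allows descent, its scalar `(k + 1)(dn - 2w - k)` being nonzero when `2w > dn`. -/
theorem eq_zero_of_lower_eq_zero {d : ℕ} {n w : ℤ} {p : MvPolynomial (Fin (d + 1)) ℂ}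
    (hp : IsWeightedHomogeneous (bidegree d) p (n, w)) (hw : d * n < 2 * w)
    (h : lower d p = 0) : p = 0 := by
  have h0 : ∀ k, (raise d)^[k] (0 : MvPolynomial (Fin (d + 1)) ℂ) = 0 := fun k =>
    Function.iterate_fixed (map_zero _) k
  have step : ∀ k : ℕ, (raise d)^[k] p = 0 → p = 0 := by
    intro k
    induction k with
    | zero => exact id
    | succ k ih =>
      intro hk
      have e := lower_iterate_raise hp k
      rw [hk, h, map_zero, h0, zero_add, eq_comm, smul_eq_zero] at e
      refine ih (e.resolve_left (mul_ne_zero (by exact_mod_cast k.succ_ne_zero) ?_))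
      have : (d : ℤ) * n - 2 * w - k ≠ 0 := by omega
      exact_mod_cast this
  refine step (d * n - w + 1).natAbs (eq_zero_of_isWeightedHomogeneous
    (isWeightedHomogeneous_iterate_raise hp _) (Or.inr ?_))
  omega

/-- Only `k = 0` is needed, for surjectivity of `lower` below the middle weight. The string formula
expresses `raise^k p` through `lower (raise^(k+1) p)` and `raise^(k+1) (lower p)`; the latter is the
same problem with `w - 1` and `k + 1`, whence the general `k`. The recursion ends at negative
weight, where everything is zero, and `r` bounds its length. -/
theorem exists_lower_eq_iterate_raise {d : ℕ} {n : ℤ} (r : ℕ) :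
    ∀ {k : ℕ} {w : ℤ} {p : MvPolynomial (Fin (d + 1)) ℂ},
      IsWeightedHomogeneous (bidegree d) p (n, w) → 2 * w + k < d * n → w < r →
      ∃ u, IsWeightedHomogeneous (bidegree d) u (n, w + k + 1) ∧
        lower d u = (raise d)^[k] p := by
  induction r with
  | zero =>
    intro k w p hp _ hr
    refine ⟨0, isWeightedHomogeneous_zero _ _ _, ?_⟩
    rw [eq_zero_of_isWeightedHomogeneous hp (Or.inl (by simpa using hr)), map_zero]
    exact (Function.iterate_fixed (map_zero _) k).symm
  | succ r ih =>
    intro k w p hp hk hr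
    have hl : IsWeightedHomogeneous (bidegree d) (lower d p) (n, w - 1) := by
      simpa [sub_eq_add_neg] using isWeightedHomogeneous_lower hp
    obtain ⟨u, hu, hu'⟩ := ih (k := k + 1) hl (by push_cast; omega) (by push_cast at hr; omega)
    have hc : ((k : ℂ) + 1) * ((d : ℂ) * n - 2 * w - k) ≠ 0 := by
      refine mul_ne_zero (by exact_mod_cast k.succ_ne_zero) ?_
      have : (d : ℤ) * n - 2 * w - k ≠ 0 := by omega
      exact_mod_cast this
    refine ⟨(((k : ℂ) + 1) * ((d : ℂ) * n - 2 * w - k))⁻¹ • ((raise d)^[k + 1] p - u), ?_, ?_⟩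
    · rw [smul_eq_C_mul]
      refine IsWeightedHomogeneous.C_mul (IsWeightedHomogeneous.sub ?_ ?_) _
      · have := isWeightedHomogeneous_iterate_raise hp (k + 1)
        rwa [show w + ((k + 1 : ℕ) : ℤ) = w + k + 1 by push_cast; ring] at this
      · rwa [show w - 1 + ((k + 1 : ℕ) : ℤ) + 1 = w + k + 1 by push_cast; ring] at hu
    · rw [(lower d).map_smul, map_sub, lower_iterate_raise hp, hu', add_sub_cancel_left,
        smul_smul, inv_mul_cancel₀ hc, one_smul]

/-! ### The dimension of the space of semi-invariants -/

/-- The exponent vectors of degree `n` and weight less than `w`. -/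
def exponents (d n w : ℕ) : Set (Fin (d + 1) →₀ ℕ) :=
  {s | ⇑s ∈ (Finset.Nat.antidiagonalTuple (d + 1) n).filter
    fun s => ∑ i : Fin (d + 1), (i : ℕ) * s i < w}

theorem mem_exponents {d n w : ℕ} {s : Fin (d + 1) →₀ ℕ} :
    s ∈ exponents d n w ↔ ∑ i, s i = n ∧ ∑ i : Fin (d + 1), (i : ℕ) * s i < w := by
  simp [exponents, Finset.Nat.mem_antidiagonalTuple]

theorem natCard_exponents (d n w : ℕ) :
    Nat.card (exponents d n w) = ((Finset.Nat.antidiagonalTuple (d + 1) n).filter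
      fun s => ∑ i : Fin (d + 1), (i : ℕ) * s i < w).card := by
  rw [← Nat.card_eq_finsetCard]
  exact Nat.card_congr (Finsupp.equivFunOnFinite.subtypeEquiv fun s => Iff.rfl)

theorem finite_exponents (d n w : ℕ) : Finite (exponents d n w) :=
  Set.Finite.preimage DFunLike.coe_injective.injOn (Finset.finite_toSet _)

/-- The polynomials in the coefficients of degree `n` all of whose terms have weight `< w`. -/
noncomputable def truncation (d n w : ℕ) : Submodule ℂ (MvPolynomial (Fin (d + 1)) ℂ) :=
  restrictSupport ℂ (exponents d n w)

theorem finite_truncation (d n w : ℕ) : Module.Finite ℂ (truncation d n w) :=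
  have := finite_exponents d n w
  Module.Finite.of_basis (basisRestrictSupport ℂ (exponents d n w))

theorem finrank_truncation (d n w : ℕ) :
    Module.finrank ℂ (truncation d n w) = ((Finset.Nat.antidiagonalTuple (d + 1) n).filter
      fun s => ∑ i : Fin (d + 1), (i : ℕ) * s i < w).card := by
  rw [← natCard_exponents]
  exact Module.finrank_eq_nat_card_basis (basisRestrictSupport ℂ (exponents d n w))

theorem mem_truncation_of_isWeightedHomogeneous {d n w v : ℕ} (hv : v < w)
    {p : MvPolynomial (Fin (d + 1)) ℂ}
    (hp : IsWeightedHomogeneous (bidegree d) p ((n : ℤ), (v : ℤ))) : p ∈ truncation d n w := by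
  refine (mem_restrictSupport_iff ℂ).2 fun s hs => ?_
  have h := hp (mem_support_iff.1 hs)
  rw [weight_bidegree, Prod.mk.injEq, Nat.cast_inj, Nat.cast_inj] at h
  exact mem_exponents.2 ⟨h.1, h.2.trans_lt hv⟩

theorem truncation_induction {d n w : ℕ} {S : Submodule ℂ (MvPolynomial (Fin (d + 1)) ℂ)}
    (h : ∀ v < w, ∀ p, IsWeightedHomogeneous (bidegree d) p ((n : ℤ), (v : ℤ)) → p ∈ S) :
    truncation d n w ≤ S := by
  rw [truncation, restrictSupport_eq_span, Submodule.span_le]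
  rintro _ ⟨s, hs, rfl⟩
  obtain ⟨h1, h2⟩ := mem_exponents.1 hs
  exact h _ h2 _ (isWeightedHomogeneous_monomial _ _ _ (by rw [weight_bidegree, h1]))

theorem lower_mem_truncation {d n w : ℕ} {p : MvPolynomial (Fin (d + 1)) ℂ}
    (hp : p ∈ truncation d n (w + 1)) : lower d p ∈ truncation d n w := by
  refine truncation_induction
    (S := (truncation d n w).comap (lower d).toLinearMap) (fun v hv p hp => ?_) hp
  have h : IsWeightedHomogeneous (bidegree d) (lower d p) ((n : ℤ), (v : ℤ) - 1) := by
    simpa [sub_eq_add_neg] using isWeightedHomogeneous_lower hp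
  rcases v with _ | v
  -- The image has weight `-1`, and no monomial does.
  · have h0 : lower d p = 0 := eq_zero_of_isWeightedHomogeneous h (Or.inl (by simp))
    simp [h0]
  · exact mem_truncation_of_isWeightedHomogeneous (Nat.lt_of_succ_lt_succ hv) (by simpa using h)

/-- The lowering operator on the terms of bounded weight. -/
noncomputable def lowerTruncation (d n w : ℕ) : truncation d n (w + 1) →ₗ[ℂ] truncation d n w :=
  (lower d).toLinearMap.restrict
    fun _ hp => lower_mem_truncation hp

/-- A weight `v < ⌊nd/2⌋` satisfies `2v < dn`, which is the solvability condition for `lower u = p`.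
-/
theorem lowerTruncation_surjective (d n : ℕ) :
    Function.Surjective (lowerTruncation d n (n * d / 2)) := by
  suffices h : truncation d n (n * d / 2) ≤ (truncation d n (n * d / 2 + 1)).map
      (lower d).toLinearMap by
    rintro ⟨p, hp⟩
    obtain ⟨u, hu, rfl⟩ := h hp
    exact ⟨⟨u, hu⟩, rfl⟩
  refine truncation_induction fun v hv p hp => ?_
  have hv' : 2 * v < d * n := by rw [mul_comm d n]; omega
  obtain ⟨u, hu, hu'⟩ := exists_lower_eq_iterate_raise (v + 1) (k := 0) hp
    (by push_cast; zify at hv'; omega) (by push_cast; omega)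
  exact ⟨u, mem_truncation_of_isWeightedHomogeneous (Nat.succ_lt_succ hv) (by simpa using hu), hu'⟩

/-- The polynomials of degree `n` in the coefficients that are killed by the lowering operator. -/
noncomputable def semiinvariants (d n : ℕ) : Submodule ℂ (MvPolynomial (Fin (d + 1)) ℂ) :=
  homogeneousSubmodule (Fin (d + 1)) ℂ n ⊓ LinearMap.ker (lower d).toLinearMap

theorem mem_semiinvariants {d n : ℕ} {p : MvPolynomial (Fin (d + 1)) ℂ} :
    p ∈ semiinvariants d n ↔ p.IsHomogeneous n ∧ lower d p = 0 := Iff.rfl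

theorem semiinvariants_le_truncation (d n : ℕ) :
    semiinvariants d n ≤ truncation d n (n * d / 2 + 1) := by
  intro p hpl
  obtain ⟨hp, hl⟩ := mem_semiinvariants.1 hpl
  refine (mem_restrictSupport_iff ℂ).2 fun s hs => ?_
  have hn : ∑ i, s i = n := by
    have h := hp (mem_support_iff.1 hs)
    rw [Finsupp.weight_apply, Finsupp.sum_fintype _ _ (by simp)] at h
    simpa using h
  refine mem_exponents.2 ⟨hn, ?_⟩
  -- Since `lower` is homogeneous, it also kills the component of `p` in the bidegree of `s`. That
  -- component lies above the middle weight, so it is zero, although its coefficient at `s` is not.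
  by_contra hw
  have h := weightedHomogeneousComponent_comm (w := bidegree d) (δ := (0, -1))
    (lower d).toLinearMap (fun m q hq => isWeightedHomogeneous_lower hq)
    (Finsupp.weight (bidegree d) s) p
  rw [Derivation.coeFn_coe, hl, map_zero] at h
  have hc := weightedHomogeneousComponent_isWeightedHomogeneous (w := bidegree d)
    (Finsupp.weight (bidegree d) s) p
  have hz : weightedHomogeneousComponent (bidegree d) (Finsupp.weight (bidegree d) s) p = 0 := by
    rw [weight_bidegree] at hc h ⊢
    refine eq_zero_of_lower_eq_zero hc ?_ h
    rw [hn, mul_comm (d : ℤ)]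
    have : n * d < 2 * ∑ i : Fin (d + 1), (i : ℕ) * s i := by omega
    exact_mod_cast this
  have := congrArg (coeff s) hz
  rw [coeff_weightedHomogeneousComponent, if_pos rfl, coeff_zero] at this
  exact mem_support_iff.1 hs this

theorem truncation_le_homogeneousSubmodule (d n w : ℕ) :
    truncation d n w ≤ homogeneousSubmodule (Fin (d + 1)) ℂ n := by
  intro p hp s hs
  have h := mem_exponents.1 ((mem_restrictSupport_iff ℂ).1 hp (mem_support_iff.2 hs))
  rw [Finsupp.weight_apply, Finsupp.sum_fintype _ _ (by simp), ← h.1]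
  simp

theorem semiinvariants_eq_map_ker (d n : ℕ) : semiinvariants d n =
    (LinearMap.ker (lowerTruncation d n (n * d / 2))).map
      (truncation d n (n * d / 2 + 1)).subtype := by
  ext p
  constructor
  · intro hp
    exact ⟨⟨p, semiinvariants_le_truncation d n hp⟩, Subtype.ext (mem_semiinvariants.1 hp).2, rfl⟩
  · rintro ⟨⟨q, hq⟩, hk, rfl⟩
    exact mem_semiinvariants.2 ⟨truncation_le_homogeneousSubmodule _ _ _ hq, congrArg Subtype.val hk⟩

theorem finite_semiinvariants (d n : ℕ) : Module.Finite ℂ (semiinvariants d n) :=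
  have := finite_truncation d n (n * d / 2 + 1)
  Submodule.finiteDimensional_of_le (semiinvariants_le_truncation d n)

theorem finrank_semiinvariants (d n : ℕ) : Module.finrank ℂ (semiinvariants d n) =
    ((Finset.Nat.antidiagonalTuple (d + 1) n).filter
      fun s => ∑ i : Fin (d + 1), (i : ℕ) * s i = n * d / 2).card := by
  have := finite_truncation d n (n * d / 2 + 1)
  have h := (lowerTruncation d n (n * d / 2)).finrank_range_add_finrank_ker
  rw [LinearMap.range_eq_top.2 (lowerTruncation_surjective d n), finrank_top,
    finrank_truncation, finrank_truncation] at h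
  rw [semiinvariants_eq_map_ker, Submodule.finrank_map_subtype_eq]
  have e : (Finset.Nat.antidiagonalTuple (d + 1) n).filter
      (fun s => ∑ i : Fin (d + 1), (i : ℕ) * s i < n * d / 2 + 1) =
      (Finset.Nat.antidiagonalTuple (d + 1) n).filter
        (fun s => ∑ i : Fin (d + 1), (i : ℕ) * s i < n * d / 2) ∪
      (Finset.Nat.antidiagonalTuple (d + 1) n).filter
        (fun s => ∑ i : Fin (d + 1), (i : ℕ) * s i = n * d / 2) := by
    rw [← Finset.filter_or]
    exact Finset.filter_congr fun s _ => by omega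
  rw [e, Finset.card_union_of_disjoint] at h
  · omega
  · exact Finset.disjoint_filter.2 fun s _ h1 h2 => by omega

end Semiinvariants

/-! ### The matrix of a linear substitution on the coefficients of a form -/

section SubstCoeff

/-- The coefficient of `x ^ (d - i) y ^ i` in `(α x + β y) ^ (d - j) (γ x + δ y) ^ j`. -/
noncomputable def substCoeff {R : Type*} [CommRing R] (d : ℕ) (α β γ δ : R) (i j : ℕ) : R :=
  ((Polynomial.C α + Polynomial.C β * Polynomial.X) ^ (d - j) *
    (Polynomial.C γ + Polynomial.C δ * Polynomial.X) ^ j).coeff i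

theorem map_substCoeff {R S : Type*} [CommRing R] [CommRing S] (φ : R →+* S) (d : ℕ)
    (α β γ δ : R) (i j : ℕ) :
    φ (substCoeff d α β γ δ i j) = substCoeff d (φ α) (φ β) (φ γ) (φ δ) i j := by
  rw [substCoeff, ← Polynomial.coeff_map]
  simp [substCoeff]

theorem substCoeff_mul {R : Type*} [CommRing R] (d : ℕ) (t α β γ δ : R) (i : ℕ) {j : ℕ}
    (hj : j ≤ d) :
    substCoeff d (t * α) (t * β) (t * γ) (t * δ) i j = t ^ d * substCoeff d α β γ δ i j := by
  rw [substCoeff, substCoeff, ← Polynomial.coeff_C_mul]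
  congr 1
  obtain ⟨k, rfl⟩ := Nat.exists_eq_add_of_le hj
  simp only [Polynomial.C_mul, Polynomial.C_pow, Nat.add_sub_cancel_left, mul_assoc, ← mul_add,
    mul_pow, pow_add]
  ring

theorem substCoeff_unipotent {R : Type*} [CommRing R] (d : ℕ) (t : R) (i j : ℕ) :
    substCoeff d 1 t 0 1 i j =
      if j ≤ i then ((d - j).choose (i - j) : R) * t ^ (i - j) else 0 := by
  have h : (Polynomial.C 1 + Polynomial.C t * Polynomial.X : Polynomial R) ^ (d - j) =
      ((1 + Polynomial.X) ^ (d - j)).comp (Polynomial.C t * Polynomial.X) := by simp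
  rw [substCoeff, h, Polynomial.C_0, Polynomial.C_1, zero_add, one_mul,
    Polynomial.coeff_mul_X_pow', Polynomial.comp_C_mul_X_coeff, Polynomial.coeff_one_add_X_pow]

theorem derivative_substCoeff_zero {R : Type*} [CommRing R] (d j : ℕ) :
    Polynomial.derivative (substCoeff d 1 (-Polynomial.X : Polynomial R) 0 1 0 j) = 0 := by
  rw [substCoeff_unipotent]
  split_ifs <;> simp

/-- The entries are `C(d - j, i - j) (-T)^(i - j)`, so this reduces to the absorption identity for
binomial coefficients. The factor `d - i` is the coefficient of `lower` at `a_{i+1}`. -/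
theorem derivative_substCoeff_succ {R : Type*} [CommRing R] (d i j : ℕ) :
    Polynomial.derivative (substCoeff d 1 (-Polynomial.X : Polynomial R) 0 1 (i + 1) j) =
      -(((d - i : ℕ) : Polynomial R) * substCoeff d 1 (-Polynomial.X) 0 1 i j) := by
  rw [substCoeff_unipotent, substCoeff_unipotent]
  by_cases hj : j ≤ i
  · rw [if_pos hj, if_pos (hj.trans i.le_succ), Nat.succ_sub hj]
    have h := Nat.choose_succ_right_eq (d - j) (i - j)
    rw [Nat.sub_sub_sub_cancel_right hj] at h
    have h' := congrArg (Nat.cast (R := Polynomial R)) h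
    push_cast at h'
    simp only [Polynomial.derivative_mul, Polynomial.derivative_natCast, zero_mul, zero_add,
      Polynomial.derivative_pow, Polynomial.derivative_neg, Polynomial.derivative_X,
      Nat.succ_eq_add_one, Nat.add_sub_cancel, map_natCast, Nat.cast_add, Nat.cast_one,
      Polynomial.C_add, Polynomial.C_1]
    linear_combination (-(-Polynomial.X) ^ (i - j)) * h'
  · rw [if_neg hj, mul_zero, neg_zero]
    split_ifs with hj'
    · have : i + 1 - j = 0 := by omega
      simp [this]
    · simp

end SubstCoeff

/-! ### Invariance under the unipotent group and the kernel of `lower` -/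

section Unipotent

open MvPolynomial

/-- The one-parameter unipotent group acting on the coefficients of the generic form. -/
noncomputable def flow (d : ℕ) :
    MvPolynomial (Fin (d + 1)) ℂ →ₐ[ℂ] Polynomial (MvPolynomial (Fin (d + 1)) ℂ) :=
  aeval fun i => ∑ j : Fin (d + 1),
    substCoeff d 1 (-Polynomial.X) 0 1 (i : ℕ) (j : ℕ) * Polynomial.C (X j)

theorem derivative_flow (d : ℕ) (p : MvPolynomial (Fin (d + 1)) ℂ) :
    Polynomial.derivative (flow d p) = -flow d (lower d p) := by
  induction p using MvPolynomial.induction_on with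
  | C a =>
    rw [derivation_C, map_zero, neg_zero, ← algebraMap_eq, AlgHom.commutes,
      Polynomial.algebraMap_apply, Polynomial.derivative_C]
  | add p q hp hq => rw [map_add, map_add, hp, hq, map_add, map_add, neg_add]
  | mul_X p i hp =>
    have hX : Polynomial.derivative (flow d (X i)) = -flow d (lower d (X i)) := by
      obtain ⟨i, hi⟩ := i
      rw [flow, aeval_X, lower, mkDerivation_X, Polynomial.derivative_sum]
      simp only [Polynomial.derivative_mul, Polynomial.derivative_C, mul_zero, add_zero]
      rcases i with _ | i
      · simp [derivative_substCoeff_zero]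
      · have e : ((d : ℂ) - ((i + 1 : ℕ) : ℂ) + 1) = ((d - i : ℕ) : ℂ) := by
          rw [Nat.cast_sub (by omega)]; push_cast; ring
        rw [if_neg i.succ_ne_zero, Nat.add_sub_cancel, e, coeffVar, dif_pos (by omega), map_mul,
          aeval_X, ← algebraMap_eq, AlgHom.commutes, map_natCast, Finset.mul_sum,
          ← Finset.sum_neg_distrib]
        refine Finset.sum_congr rfl fun j _ => ?_
        rw [derivative_substCoeff_succ d i j]
        ring
    rw [map_mul, Polynomial.derivative_mul, hp, hX, Derivation.leibniz, map_add, smul_eq_mul,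
      smul_eq_mul, map_mul, map_mul]
    ring

theorem eval₂_flow (d : ℕ) (x : Fin (d + 1) → ℂ) (t : ℂ) (p : MvPolynomial (Fin (d + 1)) ℂ) :
    (flow d p).eval₂ (eval x) t =
      eval (fun i : Fin (d + 1) => ∑ j : Fin (d + 1), substCoeff d 1 (-t) 0 1 (i : ℕ) (j : ℕ) * x j) p := by
  have h : ((Polynomial.eval₂RingHom (eval x) t).comp (flow d).toRingHom) =
      eval (fun i : Fin (d + 1) => ∑ j : Fin (d + 1), substCoeff d 1 (-t) 0 1 (i : ℕ) (j : ℕ) * x j) := by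
    refine MvPolynomial.ringHom_ext (fun a => ?_) fun i => ?_
    · change (flow d (C a)).eval₂ (eval x) t = _
      rw [← algebraMap_eq, AlgHom.commutes, Polynomial.algebraMap_apply, Polynomial.eval₂_C,
        algebraMap_eq]
      simp
    · change (Polynomial.eval₂RingHom (eval x) t) (flow d (X i)) = _
      rw [flow, aeval_X, map_sum, eval_X]
      refine Finset.sum_congr rfl fun j _ => ?_
      rw [map_mul, map_substCoeff]
      simp
  exact DFunLike.congr_fun h p

/-- By `derivative_flow`, `lower` generates the flow up to sign. If `lower d p = 0`, the flow of `p`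
is constant in `t`, hence equal to its value at `t = 0`. Conversely a constant flow has zero
derivative, and evaluating this at `t = 0` recovers `lower d p = 0`. -/
theorem lower_eq_zero_iff {d : ℕ} {p : MvPolynomial (Fin (d + 1)) ℂ} :
    lower d p = 0 ↔ ∀ (t : ℂ) (x : Fin (d + 1) → ℂ),
      eval (fun i : Fin (d + 1) => ∑ j : Fin (d + 1), substCoeff d 1 (-t) 0 1 (i : ℕ) (j : ℕ) * x j) p =
        eval x p := by
  have h0 : ∀ x : Fin (d + 1) → ℂ, (fun i : Fin (d + 1) =>
      ∑ j : Fin (d + 1), substCoeff d 1 (-0) 0 1 (i : ℕ) (j : ℕ) * x j) = x := fun x => by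
    funext i
    rw [Finset.sum_eq_single i]
    · simp [substCoeff_unipotent]
    · intro j _ hj
      rw [substCoeff_unipotent]
      split_ifs with h
      · have : (i : ℕ) - j ≠ 0 := fun h' => hj (Fin.ext (by omega))
        simp [this]
      · simp
    · simp
  constructor
  · intro h t x
    have hf := derivative_flow d p
    rw [h, map_zero, neg_zero, Polynomial.derivative_eq_zero,
      Polynomial.natDegree_eq_zero] at hf
    obtain ⟨q, hq⟩ := hf
    conv_rhs => rw [← h0 x]
    rw [← eval₂_flow, ← eval₂_flow, ← hq, Polynomial.eval₂_C, Polynomial.eval₂_C]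
  · intro h
    have hf : flow d p = Polynomial.C p := by
      ext1 k
      refine MvPolynomial.funext fun x => ?_
      rw [← Polynomial.coeff_map, ← Polynomial.coeff_map]
      congr 1
      refine Polynomial.funext fun t => ?_
      rw [Polynomial.eval_map, Polynomial.eval_map, eval₂_flow, h, Polynomial.eval₂_C]
    have hd := derivative_flow d p
    rw [hf, Polynomial.derivative_C, eq_comm, neg_eq_zero] at hd
    refine MvPolynomial.funext fun x => ?_
    rw [map_zero]
    conv_lhs => rw [← h0 x]
    rw [← eval₂_flow, hd, Polynomial.eval₂_zero]

end Unipotent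

/-! ### The action of `SL₂` in coordinates -/

section Action

open MvPolynomial

theorem expansion {d : ℕ} (f : BinaryForm d) :
    f.1 = ∑ j : Fin (d + 1), C (coords f j) * (X 0 ^ (d - (j : ℕ)) * X 1 ^ (j : ℕ)) := by
  have key : ∀ (s : Fin 2 →₀ ℕ) (j : Fin (d + 1)),
      Finsupp.single 0 (d - (j : ℕ)) + Finsupp.single 1 (j : ℕ) = s ↔
        s 0 + s 1 = d ∧ (j : ℕ) = s 1 := by
    intro s j
    have := j.isLt
    constructor
    · rintro rfl
      simp
      omega
    · rintro ⟨h1, h2⟩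
      ext i
      fin_cases i
      · simp; omega
      · simp; omega
  have hm : ∀ j : Fin (d + 1), (C (coords f j) * (X 0 ^ (d - (j : ℕ)) * X 1 ^ (j : ℕ)) :
      MvPolynomial (Fin 2) ℂ) =
      monomial (Finsupp.single 0 (d - (j : ℕ)) + Finsupp.single 1 (j : ℕ)) (coords f j) := by
    intro j
    rw [X_pow_eq_monomial, X_pow_eq_monomial, monomial_mul, C_mul_monomial, mul_one, mul_one]
  ext s
  simp only [hm, coeff_sum, coeff_monomial, key]
  by_cases hs : s 0 + s 1 = d
  · rw [Finset.sum_eq_single ⟨s 1, by omega⟩]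
    · rw [if_pos ⟨hs, rfl⟩, coords]
      congr 1
      exact ((key s ⟨s 1, by omega⟩).2 ⟨hs, rfl⟩).symm
    · intro j _ hj
      exact if_neg fun h => hj (Fin.ext h.2)
    · simp
  · rw [Finset.sum_eq_zero fun j _ => if_neg fun h => hs h.1]
    by_contra h
    have := ((mem_homogeneousSubmodule _ _).1 f.2) h
    rw [Finsupp.weight_apply, Finsupp.sum_fintype _ _ (by simp), Fin.sum_univ_two] at this
    exact hs (by simpa using this)

/-- Dehomogenising at `x = 1` loses nothing in fixed degree, and reduces the action to products of
univariate polynomials. -/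
theorem coords_eq_coeff {d : ℕ} (f : BinaryForm d) (i : Fin (d + 1)) :
    coords f i = (aeval (![1, Polynomial.X] : Fin 2 → Polynomial ℂ) f.1).coeff i := by
  rw [expansion f, map_sum, Polynomial.finsetSum_coeff, Finset.sum_eq_single i]
  · simp
  · intro j _ hj
    have : (i : ℕ) ≠ j := fun h => hj (Fin.ext h.symm)
    simp [this]
  · simp

/-- The form with given coefficients. -/
noncomputable def ofCoords {d : ℕ} (c : Fin (d + 1) → ℂ) : BinaryForm d :=
  ⟨∑ j : Fin (d + 1), C (c j) * (X 0 ^ (d - (j : ℕ)) * X 1 ^ (j : ℕ)), by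
    refine Submodule.sum_mem _ fun j _ => ?_
    rw [mem_homogeneousSubmodule]
    refine IsHomogeneous.C_mul ?_ _
    have h := (isHomogeneous_X_pow (R := ℂ) (0 : Fin 2) (d - (j : ℕ))).mul
      (isHomogeneous_X_pow (R := ℂ) (1 : Fin 2) (j : ℕ))
    rwa [Nat.sub_add_cancel (by omega)] at h⟩

theorem coords_ofCoords {d : ℕ} (c : Fin (d + 1) → ℂ) : coords (ofCoords c) = c := by
  funext i
  rw [coords_eq_coeff, ofCoords, map_sum, Polynomial.finsetSum_coeff, Finset.sum_eq_single i]
  · simp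
  · intro j _ hj
    have : (i : ℕ) ≠ j := fun h => hj (Fin.ext h.symm)
    simp [this]
  · simp

theorem coords_act {d : ℕ} (g : SL(2, ℂ)) (f : BinaryForm d) :
    coords (act g f) = fun i : Fin (d + 1) => ∑ j : Fin (d + 1),
      substCoeff d (g⁻¹ 0 0) (g⁻¹ 0 1) (g⁻¹ 1 0) (g⁻¹ 1 1) (i : ℕ) (j : ℕ) * coords f j := by
  funext i
  rw [coords_eq_coeff]
  change (aeval (![1, Polynomial.X] : Fin 2 → Polynomial ℂ) (subst g f.1)).coeff i = _
  rw [expansion f, map_sum, map_sum, Polynomial.finsetSum_coeff]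
  refine Finset.sum_congr rfl fun j _ => ?_
  rw [substCoeff, mul_comm (Polynomial.coeff _ _), ← Polynomial.coeff_C_mul]
  congr 1
  simp [subst, Polynomial.algebraMap_eq]

theorem act_mul {d : ℕ} (g h : SL(2, ℂ)) (f : BinaryForm d) : act (g * h) f = act g (act h f) := by
  refine Subtype.ext (MvPolynomial.funext fun v => ?_)
  simp only [act, eval_subst, mul_inv_rev, Matrix.mulVec_mulVec, Matrix.SpecialLinearGroup.coe_mul]

theorem act_one {d : ℕ} (f : BinaryForm d) : act 1 f = f := by
  refine Subtype.ext (MvPolynomial.funext fun v => ?_)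
  simp [act, eval_subst]

theorem eval_coords_act_of_fixes {d : ℕ} {p : MvPolynomial (Fin (d + 1)) ℂ} (hp : lower d p = 0)
    {g : SL(2, ℂ)} (hg : (g : Matrix (Fin 2) (Fin 2) ℂ).mulVec ![1, 0] = ![1, 0])
    (f : BinaryForm d) : eval (coords (act g f)) p = eval (coords f) p := by
  have h0 := congrFun hg 0
  have h1 := congrFun hg 1
  have hdet := g.det_coe
  simp only [Matrix.mulVec, dotProduct, Fin.sum_univ_two, Matrix.cons_val_zero,
    Matrix.cons_val_one, mul_one, mul_zero, add_zero] at h0 h1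
  -- The first column is `(1, 0)`, so the determinant forces the last entry to be `1` and `g` is
  -- unipotent.
  rw [Matrix.det_fin_two, h0, h1, one_mul, mul_zero, sub_zero] at hdet
  rw [coords_act, Matrix.SpecialLinearGroup.SL2_inv_expl]
  simpa [h0, h1, hdet] using lower_eq_zero_iff.1 hp (g 0 1) (coords f)

theorem exists_mulVec_eq {v : Fin 2 → ℂ} (hv : v ≠ 0) :
    ∃ g : SL(2, ℂ), (g : Matrix (Fin 2) (Fin 2) ℂ).mulVec ![1, 0] = v := by
  by_cases h0 : v 0 = 0
  · have h1 : v 1 ≠ 0 := fun h1 => hv (by ext i; fin_cases i <;> assumption)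
    refine ⟨⟨!![v 0, -(v 1)⁻¹; v 1, 0], by simp [Matrix.det_fin_two, h1]⟩, ?_⟩
    ext i; fin_cases i <;> simp [Matrix.mulVec, dotProduct, Fin.sum_univ_two]
  · refine ⟨⟨!![v 0, 0; v 1, (v 0)⁻¹], by simp [Matrix.det_fin_two, h0]⟩, ?_⟩
    ext i; fin_cases i <;> simp [Matrix.mulVec, dotProduct, Fin.sum_univ_two]

end Action

/-! ### Homogeneity under substitution and scaling -/

section Homogeneity

open MvPolynomial

theorem isWeightedHomogeneous_aeval {σ τ M : Type*} [AddCommMonoid M] {w : σ → M} {w' : τ → M}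
    {m : M} {p : MvPolynomial σ ℂ} (hp : IsWeightedHomogeneous w p m) {f : σ → MvPolynomial τ ℂ}
    (hf : ∀ i, IsWeightedHomogeneous w' (f i) (w i)) :
    IsWeightedHomogeneous w' (aeval f p) m := by
  induction hp using IsWeightedHomogeneous.induction_on with
  | zero => rw [map_zero]; exact isWeightedHomogeneous_zero _ _ _
  | add p q _ _ h1 h2 => rw [map_add]; exact h1.add h2
  | monomial s r hr =>
    rw [aeval_monomial, algebraMap_eq, ← hr, Finsupp.weight_apply]
    exact IsWeightedHomogeneous.C_mul
      (IsWeightedHomogeneous.prod _ _ _ fun i _ => (hf i).pow (s i)) r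

theorem eval_smul_of_isHomogeneous {σ : Type*} {n : ℕ} {p : MvPolynomial σ ℂ}
    (hp : p.IsHomogeneous n) (t : ℂ) (x : σ → ℂ) :
    eval (fun i => t * x i) p = t ^ n * eval x p := by
  induction hp using IsWeightedHomogeneous.induction_on with
  | zero => simp
  | add p q _ _ h1 h2 => rw [map_add, map_add, h1, h2, mul_add]
  | monomial s r hr =>
    rw [eval_monomial, eval_monomial, ← hr, Finsupp.weight_apply, Finsupp.sum, Finsupp.prod,
      Finsupp.prod]
    simp only [mul_pow, Finset.prod_mul_distrib, Finset.prod_pow_eq_pow_sum, Pi.one_apply,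
      smul_eq_mul, mul_one]
    ring

end Homogeneity

/-! ### Covariants and their leading coefficients -/

section Covariants

open MvPolynomial

/-- The degree in the coefficients of the form. -/
abbrev formDegree (d : ℕ) : Fin (d + 1) ⊕ Fin 2 → ℕ := Sum.elim (fun _ => 1) (fun _ => 0)

theorem mem_covariantsOfDegree {d n : ℕ} {F : MvPolynomial (Fin (d + 1) ⊕ Fin 2) ℂ} :
    F ∈ covariantsOfDegree d n ↔
      (∀ (g : SL(2, ℂ)) (f : BinaryForm d) (v : Fin 2 → ℂ),
        value F (act g f) ((g : Matrix (Fin 2) (Fin 2) ℂ).mulVec v) = value F f v) ∧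
      IsWeightedHomogeneous (formDegree d) F n := Iff.rfl

theorem eq_of_value_eq {d : ℕ} {F G : MvPolynomial (Fin (d + 1) ⊕ Fin 2) ℂ}
    (h : ∀ (f : BinaryForm d) (v : Fin 2 → ℂ), v ≠ 0 → value F f v = value G f v) : F = G := by
  -- Multiplying by the first coordinate of the point makes both sides vanish at `v = 0`, where the
  -- hypothesis is silent.
  refine mul_left_cancel₀ (X_ne_zero (Sum.inr 0)) (MvPolynomial.funext fun x => ?_)
  rw [map_mul, map_mul, eval_X]
  by_cases hx : x (Sum.inr 0) = 0
  · rw [hx, zero_mul, zero_mul]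
  · have := h (ofCoords (x ∘ Sum.inl)) (x ∘ Sum.inr) fun h0 => hx (congrFun h0 0)
    rw [value, value, coords_ofCoords, Sum.elim_comp_inl_inr] at this
    rw [this]

/-- The restriction of a polynomial function of a form and a point to the point `(1, 0)`. -/
noncomputable def leading (d : ℕ) :
    MvPolynomial (Fin (d + 1) ⊕ Fin 2) ℂ →ₐ[ℂ] MvPolynomial (Fin (d + 1)) ℂ :=
  aeval (Sum.elim X fun i => C ((![1, 0] : Fin 2 → ℂ) i))

theorem eval_leading {d : ℕ} (F : MvPolynomial (Fin (d + 1) ⊕ Fin 2) ℂ) (f : BinaryForm d) :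
    eval (coords f) (leading d F) = value F f ![1, 0] := by
  have h : (eval (coords f)).comp (leading d).toRingHom =
      eval (Sum.elim (coords f) (![1, 0] : Fin 2 → ℂ)) := by
    refine MvPolynomial.ringHom_ext (fun a => ?_) fun i => ?_
    · simp [leading]
    · rcases i with i | i <;> simp [leading]
  exact DFunLike.congr_fun h F

theorem leading_mem_semiinvariants {d n : ℕ} {F : MvPolynomial (Fin (d + 1) ⊕ Fin 2) ℂ}
    (hF : F ∈ covariantsOfDegree d n) : leading d F ∈ semiinvariants d n := by
  obtain ⟨hc, hh⟩ := mem_covariantsOfDegree.1 hF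
  refine mem_semiinvariants.2 ⟨isWeightedHomogeneous_aeval hh ?_, ?_⟩
  · rintro (i | i)
    · exact isWeightedHomogeneous_X ℂ 1 i
    · exact isWeightedHomogeneous_C _ _
  · refine lower_eq_zero_iff.2 fun t x => ?_
    obtain ⟨u, hu⟩ : ∃ u : SL(2, ℂ), (u : Matrix (Fin 2) (Fin 2) ℂ) = !![1, t; 0, 1] :=
      ⟨⟨!![1, t; 0, 1], by simp [Matrix.det_fin_two]⟩, rfl⟩
    have h := hc u (ofCoords x) ![1, 0]
    have hv : (u : Matrix (Fin 2) (Fin 2) ℂ).mulVec ![1, 0] = ![1, 0] := by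
      rw [hu]
      ext i; fin_cases i <;> simp [Matrix.mulVec, dotProduct, Fin.sum_univ_two]
    rw [hv, ← eval_leading, ← eval_leading, coords_act, coords_ofCoords,
      Matrix.SpecialLinearGroup.SL2_inv_expl] at h
    simpa [hu] using h

theorem value_eq_eval_leading {d n : ℕ} {F : MvPolynomial (Fin (d + 1) ⊕ Fin 2) ℂ}
    (hF : F ∈ covariantsOfDegree d n) (g : SL(2, ℂ)) (f : BinaryForm d) :
    value F f ((g : Matrix (Fin 2) (Fin 2) ℂ).mulVec ![1, 0]) =
      eval (coords (act g⁻¹ f)) (leading d F) := by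
  rw [eval_leading, ← (mem_covariantsOfDegree.1 hF).1 g (act g⁻¹ f), ← act_mul, mul_inv_cancel, act_one]

theorem leading_injOn {d n : ℕ} {F G : MvPolynomial (Fin (d + 1) ⊕ Fin 2) ℂ}
    (hF : F ∈ covariantsOfDegree d n) (hG : G ∈ covariantsOfDegree d n)
    (h : leading d F = leading d G) : F = G := by
  refine eq_of_value_eq fun f v hv => ?_
  obtain ⟨g, rfl⟩ := exists_mulVec_eq hv
  rw [value_eq_eval_leading hF, value_eq_eval_leading hG, h]

/-- The pullback of polynomial functions along `(f, v) ↦ (g f, g v)`. -/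
noncomputable def pullback (d : ℕ) (g : SL(2, ℂ)) :
    MvPolynomial (Fin (d + 1) ⊕ Fin 2) ℂ →ₐ[ℂ] MvPolynomial (Fin (d + 1) ⊕ Fin 2) ℂ :=
  aeval (Sum.elim
    (fun i => ∑ j : Fin (d + 1), C (substCoeff d (g⁻¹ 0 0) (g⁻¹ 0 1) (g⁻¹ 1 0) (g⁻¹ 1 1)
      (i : ℕ) (j : ℕ)) * X (Sum.inl j))
    (fun i => ∑ j : Fin 2, C (g i j) * X (Sum.inr j)))

theorem value_pullback {d : ℕ} (g : SL(2, ℂ)) (F : MvPolynomial (Fin (d + 1) ⊕ Fin 2) ℂ)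
    (f : BinaryForm d) (v : Fin 2 → ℂ) :
    value (pullback d g F) f v =
      value F (act g f) ((g : Matrix (Fin 2) (Fin 2) ℂ).mulVec v) := by
  have h : (eval (Sum.elim (coords f) v)).comp (pullback d g).toRingHom =
      eval (Sum.elim (coords (act g f)) ((g : Matrix (Fin 2) (Fin 2) ℂ).mulVec v)) := by
    refine MvPolynomial.ringHom_ext (fun a => ?_) fun i => ?_
    · simp [pullback]
    · rcases i with i | i
      · simp [pullback, coords_act]
      · fin_cases i <;> simp [pullback]
  exact DFunLike.congr_fun h F

/-- The substitution of `f(α x + β y, γ x + δ y)` for `f` in a polynomial in the coefficients of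
`f`, where `α, β, γ, δ` are polynomials in the coordinates of a point. -/
noncomputable def polySubst (d : ℕ) (α β γ δ : MvPolynomial (Fin 2) ℂ) :
    MvPolynomial (Fin (d + 1)) ℂ →ₐ[ℂ] MvPolynomial (Fin (d + 1) ⊕ Fin 2) ℂ :=
  aeval fun i => ∑ j : Fin (d + 1),
    rename Sum.inr (substCoeff d α β γ δ (i : ℕ) (j : ℕ)) * X (Sum.inl j)

theorem value_polySubst {d : ℕ} (α β γ δ : MvPolynomial (Fin 2) ℂ)
    (p : MvPolynomial (Fin (d + 1)) ℂ) (f : BinaryForm d) (v : Fin 2 → ℂ) :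
    value (polySubst d α β γ δ p) f v =
      eval (fun i : Fin (d + 1) => ∑ j : Fin (d + 1), substCoeff d (eval v α) (eval v β)
        (eval v γ) (eval v δ) (i : ℕ) (j : ℕ) * coords f j) p := by
  have h : (eval (Sum.elim (coords f) v)).comp (polySubst d α β γ δ).toRingHom =
      eval (fun i : Fin (d + 1) => ∑ j : Fin (d + 1), substCoeff d (eval v α) (eval v β)
        (eval v γ) (eval v δ) (i : ℕ) (j : ℕ) * coords f j) := by
    refine MvPolynomial.ringHom_ext (fun a => ?_) fun i => ?_
    · simp [polySubst]
    · simp [polySubst, eval_rename, map_substCoeff]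
  exact DFunLike.congr_fun h p

theorem isWeightedHomogeneous_polySubst {d n : ℕ} (α β γ δ : MvPolynomial (Fin 2) ℂ)
    {p : MvPolynomial (Fin (d + 1)) ℂ} (hp : p.IsHomogeneous n) :
    IsWeightedHomogeneous (formDegree d) (polySubst d α β γ δ p) n := by
  refine isWeightedHomogeneous_aeval hp fun i => IsWeightedHomogeneous.sum _ _ _ fun j _ => ?_
  have h : IsWeightedHomogeneous (formDegree d) (rename (Sum.inr : Fin 2 → Fin (d + 1) ⊕ Fin 2)
      (substCoeff d α β γ δ (i : ℕ) (j : ℕ))) 0 := by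
    rw [rename_eq_aeval]
    refine isWeightedHomogeneous_aeval (w := fun _ => 0) (fun s _ => ?_) fun i : Fin 2 =>
      isWeightedHomogeneous_X ℂ (formDegree d) (Sum.inr i)
    simp [Finsupp.weight_apply]
  simpa using h.mul (isWeightedHomogeneous_X ℂ (formDegree d) (Sum.inl j))

theorem value_polySubst_of_eq_mul {d n : ℕ} {α β γ δ : MvPolynomial (Fin 2) ℂ}
    {p : MvPolynomial (Fin (d + 1)) ℂ} (hp : p.IsHomogeneous n) {v : Fin 2 → ℂ} {t : ℂ}
    {g : SL(2, ℂ)} (hα : eval v α = t * g 0 0) (hβ : eval v β = t * g 0 1)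
    (hγ : eval v γ = t * g 1 0) (hδ : eval v δ = t * g 1 1) (f : BinaryForm d) :
    value (polySubst d α β γ δ p) f v = t ^ (d * n) * eval (coords (act g⁻¹ f)) p := by
  rw [value_polySubst, pow_mul, ← eval_smul_of_isHomogeneous hp, coords_act, inv_inv]
  congr 2
  funext i
  rw [Finset.mul_sum]
  refine Finset.sum_congr rfl fun j _ => ?_
  rw [hα, hβ, hγ, hδ, substCoeff_mul _ _ _ _ _ _ _ (by omega), mul_assoc]

/-- Here `h⁻¹ g` fixes `(1, 0)`, so `p` does not see it. Thus `p(g⁻¹ f)` depends on `g` only through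
`g (1, 0)`, and defines a function of `f` and a nonzero vector. -/
theorem eval_coords_act_inv_eq {d : ℕ} {p : MvPolynomial (Fin (d + 1)) ℂ} (hp : lower d p = 0)
    {g h : SL(2, ℂ)} (hgh : (g : Matrix (Fin 2) (Fin 2) ℂ).mulVec ![1, 0] =
      (h : Matrix (Fin 2) (Fin 2) ℂ).mulVec ![1, 0]) (f : BinaryForm d) :
    eval (coords (act g⁻¹ f)) p = eval (coords (act h⁻¹ f)) p := by
  have e : h⁻¹ = h⁻¹ * g * g⁻¹ := by group
  rw [e, act_mul (h⁻¹ * g), eval_coords_act_of_fixes (g := h⁻¹ * g) hp]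
  rw [Matrix.SpecialLinearGroup.coe_mul, ← Matrix.mulVec_mulVec, hgh, Matrix.mulVec_mulVec,
    ← Matrix.SpecialLinearGroup.coe_mul, inv_mul_cancel, Matrix.SpecialLinearGroup.coe_one,
    Matrix.one_mulVec]

/-- The function `(f, g (1, 0)) ↦ p(g⁻¹ f)` is regular on `v ≠ 0`: it equals `P / v₀^(dn)` where `v₀
≠ 0` and `Q / v₁^(dn)` where `v₁ ≠ 0`. Since `v₀` and `v₁` are coprime, the denominators must
cancel, and the function is a polynomial. -/
theorem exists_polynomial_of_semiinvariant {d n : ℕ} {p : MvPolynomial (Fin (d + 1)) ℂ}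
    (hp : p ∈ semiinvariants d n) :
    ∃ F : MvPolynomial (Fin (d + 1) ⊕ Fin 2) ℂ, IsWeightedHomogeneous (formDegree d) F n ∧
      ∀ (g : SL(2, ℂ)) (f : BinaryForm d),
        value F f ((g : Matrix (Fin 2) (Fin 2) ℂ).mulVec ![1, 0]) =
          eval (coords (act g⁻¹ f)) p := by
  obtain ⟨hh, hl⟩ := mem_semiinvariants.1 hp
  -- The entries are those of `v₀ · !![v₀, 0; v₁, v₀⁻¹]`, and for `Q` those of `v₁ · !![v₀, -v₁⁻¹;
  -- v₁, 0]`: matrices of `SL₂` sending `(1, 0)` to `v`, cleared of denominators. Scaling the matrix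
  -- by `t` multiplies the value of `p` by `t^(dn)`.
  set P := polySubst d (X 0 * X 0) 0 (X 0 * X 1) 1 p with hP
  set Q := polySubst d (X 1 * X 0) (-1) (X 1 * X 1) 0 p with hQ
  have hPv : ∀ (g : SL(2, ℂ)) (f : BinaryForm d) (v : Fin 2 → ℂ),
      (g : Matrix (Fin 2) (Fin 2) ℂ).mulVec ![1, 0] = v → v 0 ≠ 0 →
        value P f v = v 0 ^ (d * n) * eval (coords (act g⁻¹ f)) p := by
    intro g f v hv h0
    rw [eval_coords_act_inv_eq hl (h := ⟨!![v 0, 0; v 1, (v 0)⁻¹],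
      by simp [Matrix.det_fin_two, h0]⟩)]
    · exact value_polySubst_of_eq_mul hh (by simp) (by simp) (by simp) (by simp [h0]) f
    · rw [hv]
      ext i; fin_cases i <;> simp [Matrix.mulVec, dotProduct, Fin.sum_univ_two]
  have hQv : ∀ (g : SL(2, ℂ)) (f : BinaryForm d) (v : Fin 2 → ℂ),
      (g : Matrix (Fin 2) (Fin 2) ℂ).mulVec ![1, 0] = v → v 1 ≠ 0 →
        value Q f v = v 1 ^ (d * n) * eval (coords (act g⁻¹ f)) p := by
    intro g f v hv h1
    rw [eval_coords_act_inv_eq hl (h := ⟨!![v 0, -(v 1)⁻¹; v 1, 0],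
      by simp [Matrix.det_fin_two, h1]⟩)]
    · exact value_polySubst_of_eq_mul hh (by simp) (by simp [h1]) (by simp) (by simp) f
    · rw [hv]
      ext i; fin_cases i <;> simp [Matrix.mulVec, dotProduct, Fin.sum_univ_two]
  have hPQ : X (Sum.inr 1) ^ (d * n) * P = X (Sum.inr 0) ^ (d * n) * Q := by
    refine mul_left_cancel₀ (mul_ne_zero (X_ne_zero (Sum.inr 0)) (X_ne_zero (Sum.inr 1)))
      (eq_of_value_eq fun f v hv => ?_)
    obtain ⟨g, hg⟩ := exists_mulVec_eq hv
    have hP1 := hPv g f v hg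
    have hQ1 := hQv g f v hg
    simp only [value, map_mul, map_pow, eval_X, Sum.elim_inr] at hP1 hQ1 ⊢
    by_cases h0 : v 0 = 0
    · simp [h0]
    by_cases h1 : v 1 = 0
    · simp [h1]
    rw [hP1 h0, hQ1 h1]
    ring
  have hdvd : (X (Sum.inr 0) : MvPolynomial (Fin (d + 1) ⊕ Fin 2) ℂ) ^ (d * n) ∣ P := by
    refine X_prime.pow_dvd_of_dvd_mul_left _ (fun h => ?_) ⟨Q, hPQ⟩
    have := X_dvd_X.1 (X_prime.dvd_of_dvd_pow h)
    simp at this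
  obtain ⟨F, hF⟩ := hdvd
  have hQF : Q = X (Sum.inr 1) ^ (d * n) * F := by
    refine mul_left_cancel₀ (pow_ne_zero (d * n) (X_ne_zero (Sum.inr 0))) ?_
    rw [← hPQ, hF]
    ring
  refine ⟨F, fun s hs => ?_, fun g f => ?_⟩
  -- Coordinates of the point have degree `0` in the form, so `F` inherits the degree of `P =
  -- v₀^(dn) F`.
  · have h := isWeightedHomogeneous_polySubst (X 0 * X 0) 0 (X 0 * X 1) 1 hh
    rw [← hP, hF, mul_comm, X_pow_eq_monomial] at h
    have h' := @h (s + Finsupp.single (Sum.inr 0) (d * n))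
      (by rwa [coeff_mul_monomial, mul_one])
    rw [map_add, Finsupp.weight_single] at h'
    simpa using h'
  · set v := (g : Matrix (Fin 2) (Fin 2) ℂ).mulVec ![1, 0] with hv
    by_cases h0 : v 0 = 0
    · have h1 : v 1 ≠ 0 := by
        intro h1
        have hdet := g.det_coe
        simp only [hv, Matrix.mulVec, dotProduct, Fin.sum_univ_two, Matrix.cons_val_zero,
          Matrix.cons_val_one, mul_one, mul_zero, add_zero] at h0 h1
        rw [Matrix.det_fin_two, h0, h1, zero_mul, mul_zero, sub_zero] at hdet
        exact zero_ne_one hdet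
      refine mul_left_cancel₀ (pow_ne_zero (d * n) h1) ?_
      rw [← hQv g f v rfl h1, hQF]
      simp [value]
    · refine mul_left_cancel₀ (pow_ne_zero (d * n) h0) ?_
      rw [← hPv g f v rfl h0, hF]
      simp [value]

theorem exists_covariant_of_semiinvariant {d n : ℕ} {p : MvPolynomial (Fin (d + 1)) ℂ}
    (hp : p ∈ semiinvariants d n) : ∃ F ∈ covariantsOfDegree d n, leading d F = p := by
  obtain ⟨F, hF, hv⟩ := exists_polynomial_of_semiinvariant hp
  refine ⟨F, mem_covariantsOfDegree.2 ⟨fun g f v => ?_, hF⟩, MvPolynomial.funext fun x => ?_⟩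
  -- Passing to the pullback makes invariance an identity of polynomials, so it suffices to test it
  -- at `v = h (1, 0)`. There it reads `p((gh)⁻¹ g f) = p(h⁻¹ f)`.
  · rw [← value_pullback]
    congr 1
    refine eq_of_value_eq fun f v h0 => ?_
    obtain ⟨h, rfl⟩ := exists_mulVec_eq h0
    rw [value_pullback, Matrix.mulVec_mulVec, ← Matrix.SpecialLinearGroup.coe_mul, hv, hv,
      ← act_mul, mul_inv_rev, inv_mul_cancel_right]
  · have h := eval_leading F (ofCoords x)
    have h1 := hv 1 (ofCoords x)
    rw [Matrix.SpecialLinearGroup.coe_one, Matrix.one_mulVec, inv_one, act_one] at h1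
    rw [h1, coords_ofCoords] at h
    exact h

/-- Covariants correspond to semi-invariants through their leading coefficients. -/
noncomputable def leadingEquiv (d n : ℕ) : covariantsOfDegree d n ≃ₗ[ℂ] semiinvariants d n :=
  LinearEquiv.ofBijective
    ((leading d).toLinearMap.restrict fun _ hF => leading_mem_semiinvariants hF)
    ⟨fun F G h => Subtype.ext (leading_injOn F.2 G.2 (congrArg Subtype.val h)), fun p => by
      obtain ⟨F, hF, h⟩ := exists_covariant_of_semiinvariant p.2
      exact ⟨⟨F, hF⟩, Subtype.ext h⟩⟩

end Covariants

end BinaryForms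

theorem theorem3 (d : ℕ) (hd : 1 ≤ d) :
    (∀ n : ℕ, Module.Finite ℂ (BinaryForms.covariantsOfDegree d n)) ∧
    BinaryForms.poincareSeries d =
      ∑ k ∈ (Finset.range d).filter (fun k => 2 * k < d),
        BinaryForms.phi (d - 2 * k)
          ((-1) ^ k * PowerSeries.X ^ (k * (k + 1)) * (1 + PowerSeries.X) *
            (BinaryForms.qShifted (PowerSeries.X ^ 2) (PowerSeries.X ^ 2) k *
              BinaryForms.qShifted (PowerSeries.X ^ 2) (PowerSeries.X ^ 2) (d - k))⁻¹) := by
  refine ⟨fun n => ?_, PowerSeries.ext fun n => ?_⟩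
  · have := BinaryForms.finite_semiinvariants d n
    exact Module.Finite.equiv (BinaryForms.leadingEquiv d n).symm
  · rw [BinaryForms.coeff_sum_phi d hd, BinaryForms.poincareSeries, PowerSeries.coeff_mk,
      (BinaryForms.leadingEquiv d n).finrank_eq, BinaryForms.finrank_semiinvariants]
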